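/- Let $(W,S)$ be a Coxeter system ($S$ possibly infinite) with length function $\ell$, and let $S=I\cup J$ be such that no element of $I$ is conjugate in $W$ to an element of $J$ (in particular the union is disjoint). Let $W_I=\langle I\rangle$, let $\widetilde J=\{wsw^{-1} : w\in W_I,\ s\in J\}$, and let $\widetilde W=\langle \widetilde J\rangle$. Let $T=\bigcup_{w\in W} wSw^{-1}$ be the set of reflections of $W$; for $w\in W$ put $N(w)=\{t\in T : \ell(wt)<\ell(w)\}$, and for a subgroup $W'$ of $W$ generated by reflections let $\chi(W')=\{t\in T : N(t)\cap W'=\{t\}\}$ be its set of canonical Coxeter generators. Then: (a) $W=\widetilde W\rtimes W_I$, an internal semidirect product with $\widetilde W$ normal (that is, $\widetilde W$ is normal in $W$, $W=\widetilde W W_I$ and $\widetilde W\cap W_I=\{1\}$); (b) $(\widetilde W,\widetilde J)$ is a Coxeter system; (c) $\widetilde J=\chi(\widetilde W)$, i.e. $\widetilde J$ is the set of canonical Coxeter generators of $\widetilde W$; (d) for every $w\in W_I$ one has $\widetilde W w=w\widetilde W$, and $w$ is the unique element of minimal length $\ell$ in this coset. -/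

import Mathlib

open scoped Pointwise

/-- `(H, X)` is a Coxeter system: the group `H` has a Coxeter presentation (with respect to some
Coxeter matrix indexed by the set `X` itself) whose simple reflections are the elements of `X`. -/
def IsCoxeterPair {W : Type*} [Group W] (H : Subgroup W) (X : Set W) : Prop :=
  ∃ (M : CoxeterMatrix X) (cs : CoxeterSystem M H), ∀ x : X, (cs.simple x : W) = x

namespace CoxeterSystem

variable {B W : Type*} [Group W] {M : CoxeterMatrix B}

/-- `N(w) = {t ∈ T | ℓ(wt) < ℓ(w)}`, where `T` is the set of all reflections of `W`. -/
def inversionSet (cs : CoxeterSystem M W) (w : W) : Set W :=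
  {t | cs.IsReflection t ∧ cs.length (w * t) < cs.length w}

/-- `χ(H) = {t ∈ T | N(t) ∩ H = {t}}`, the set of canonical Coxeter generators of a subgroup `H`
generated by reflections. -/
def canonicalGenerators (cs : CoxeterSystem M W) (H : Subgroup W) : Set W :=
  {t | cs.IsReflection t ∧ cs.inversionSet t ∩ (H : Set W) = {t}}

end CoxeterSystem

/-- The set of all `w s w⁻¹` with `w` in the subgroup generated by `I` and `s ∈ J`. -/
def conjugatesUnder {W : Type*} [Group W] (I J : Set W) : Set W :=
  {t | ∃ w ∈ Subgroup.closure I, ∃ s ∈ J, t = w * s * w⁻¹}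

/-- The elements of minimal length in a subset `C` of `W`. -/
def CoxeterSystem.minLengthElements {B W : Type*} [Group W] {M : CoxeterMatrix B}
    (cs : CoxeterSystem M W) (C : Set W) : Set W :=
  {x | x ∈ C ∧ ∀ y ∈ C, cs.length x ≤ cs.length y}

/-! An odd `M i j` makes the two simple reflections conjugate, so `M i j` is even whenever exactly
one of them lies in `I`. Hence deleting the letters outside `I` respects the Coxeter relations and
gives a `retraction` of `W` onto `W_I`. It kills `Jt`, which gives (a), and it shortens any element
with a reduced word leaving `I`, which gives (d).

For (c), inversions are detected by a `ZMod 2`-valued cocycle (`inversionParity`). Elements of `W_I`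
have no inversions in `Wt`, so `w * s * w⁻¹` has only itself; conversely, a reduced word of a
canonical generator must leave `I`, and its last letter outside `I` yields an inversion in `Jt`.

For (b), `W_I` acts by conjugation on the abstract Coxeter group `G` with generators `Jt`. Evenness
again gives a homomorphism `W → G ⋊ W_I` whose composite with `G → W` is the inclusion of `G`, so `G
→ W` is injective. -/

lemma Function.End.mul_apply' {α : Type*} (f g : Function.End α) (x : α) :
    (f * g) x = f (g x) := rfl

lemma Function.End.one_apply' {α : Type*} (x : α) : (1 : Function.End α) x = x := rfl

namespace CoxeterSystem

variable {B W : Type*} [Group W] {M : CoxeterMatrix B} (cs : CoxeterSystem M W)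

/-! ### The strong exchange property -/

open Classical in
/-- The action of a simple reflection on pairs of an element of the group and a sign. -/
noncomputable def signedConj (i : B) : Function.End (W × ZMod 2) :=
  fun p ↦ (cs.simple i * p.1 * cs.simple i, p.2 + if p.1 = cs.simple i then 1 else 0)

lemma simple_mul_pow_conj (i j : B) (k : ℕ) :
    (cs.simple i * cs.simple j) ^ k * cs.simple j * (cs.simple i * cs.simple j) ^ k =
      cs.simple j := by
  induction k with
  | zero => simp
  | succ k ih =>
    have : cs.simple i * cs.simple j * cs.simple j * (cs.simple i * cs.simple j) =
        cs.simple j := by simp [← mul_assoc]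
    calc
      _ = (cs.simple i * cs.simple j) ^ k * (cs.simple i * cs.simple j) * cs.simple j *
          ((cs.simple i * cs.simple j) * (cs.simple i * cs.simple j) ^ k) := by
        rw [← pow_succ, ← pow_succ']
      _ = (cs.simple i * cs.simple j) ^ k *
          (cs.simple i * cs.simple j * cs.simple j * (cs.simple i * cs.simple j)) *
          (cs.simple i * cs.simple j) ^ k := by simp only [mul_assoc]
      _ = _ := by rw [this, ih]

-- The sign records how often `t` occurs in the inversion sequence of the alternating word of length
-- `2 * k`.
open Classical in
lemma signedConj_mul_pow_apply (i j : B) (k : ℕ) (t : W) (e : ZMod 2) :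
    ((cs.signedConj i * cs.signedConj j) ^ k) (t, e) =
      ((cs.simple i * cs.simple j) ^ k * t * ((cs.simple i * cs.simple j) ^ k)⁻¹,
        e + ∑ n ∈ Finset.range (2 * k),
          if t = cs.simple j * (cs.simple i * cs.simple j) ^ n then 1 else 0) := by
  induction k with
  | zero => simp [Function.End.one_apply']
  | succ k ih =>
    rw [pow_succ', Function.End.mul_apply', ih, Function.End.mul_apply']
    set p := cs.simple i * cs.simple j with hp
    clear_value p
    have hk : p ^ k * cs.simple j * p ^ k = cs.simple j := hp ▸ cs.simple_mul_pow_conj i j k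
    -- The two new sign tests, by `j` and then by `i`, are the summands `n = 2 * k` and `n = 2 * k +
    -- 1`.
    have h1 : p ^ k * t * (p ^ k)⁻¹ = cs.simple j ↔ t = cs.simple j * p ^ (2 * k) := by
      rw [two_mul, pow_add, mul_inv_eq_iff_eq_mul, ← mul_assoc]
      nth_rewrite 1 [← hk]
      simp only [mul_assoc, mul_right_inj]
    have h2 : cs.simple j * (p ^ k * t * (p ^ k)⁻¹) * cs.simple j = cs.simple i ↔
        t = cs.simple j * p ^ (2 * k + 1) := by
      have : cs.simple j * (p ^ k * t * (p ^ k)⁻¹) * cs.simple j = cs.simple i ↔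
          p ^ k * t * (p ^ k)⁻¹ = cs.simple j * p := by
        generalize p ^ k * t * (p ^ k)⁻¹ = c
        constructor
        · intro h
          rw [hp, ← h]
          simp [← mul_assoc]
        · intro h
          rw [h, hp]
          simp [← mul_assoc]
      have h3 : cs.simple j * p * p ^ k = p ^ k * (cs.simple j * p ^ (2 * k + 1)) := by
        calc _ = p ^ k * cs.simple j * p ^ k * p * p ^ k := by rw [hk]
          _ = _ := by
            rw [show 2 * k + 1 = k + 1 + k by ring, pow_add, pow_succ]
            simp only [mul_assoc]
      rw [this, mul_inv_eq_iff_eq_mul, h3, mul_right_inj]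
    rw [show 2 * (k + 1) = 2 * k + 1 + 1 by ring, Finset.sum_range_succ, Finset.sum_range_succ]
    simp only [signedConj, h1, h2]
    refine Prod.ext ?_ ?_
    · simp [pow_succ', hp, mul_assoc]
    · simp only [add_assoc]

lemma isLiftable_signedConj : M.IsLiftable cs.signedConj := by
  classical
  intro i j
  funext ⟨t, e⟩
  -- The summands have period `M i j`, so the two halves of the sum agree and cancel mod 2.
  rw [signedConj_mul_pow_apply, cs.simple_mul_simple_pow, two_mul, Finset.sum_range_add]
  simp [pow_add, CharTwo.add_self_eq_zero, Function.End.one_apply']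

/-- The signed conjugation action of a Coxeter group. -/
noncomputable def signedConjHom : W →* Function.End (W × ZMod 2) :=
  cs.lift ⟨cs.signedConj, cs.isLiftable_signedConj⟩

lemma signedConjHom_simple (i : B) : cs.signedConjHom (cs.simple i) = cs.signedConj i :=
  cs.lift_apply_simple cs.isLiftable_signedConj i

open Classical in
lemma signedConjHom_wordProd (ω : List B) (t : W) (e : ZMod 2) :
    cs.signedConjHom (cs.wordProd ω) (t, e) =
      (cs.wordProd ω * t * (cs.wordProd ω)⁻¹, e + (cs.rightInvSeq ω).count t) := by
  induction ω with
  | nil => simp [Function.End.one_apply']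
  | cons i ω ih =>
    rw [wordProd_cons, map_mul, Function.End.mul_apply', ih,
      signedConjHom_simple, signedConj, rightInvSeq, List.count_cons]
    have : cs.wordProd ω * t * (cs.wordProd ω)⁻¹ = cs.simple i ↔
        (cs.wordProd ω)⁻¹ * cs.simple i * cs.wordProd ω = t := by
      constructor <;> intro h <;> rw [← h] <;> group
    refine Prod.ext ?_ ?_
    · simp [mul_assoc]
    · simp only [this, beq_iff_eq]
      split_ifs <;> simp [add_assoc]

/-- The sign by which `w` acts on `t`. -/
noncomputable def inversionParity (w t : W) : ZMod 2 := (cs.signedConjHom w (t, 0)).2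

open Classical in
lemma inversionParity_wordProd (ω : List B) (t : W) :
    cs.inversionParity (cs.wordProd ω) t = (cs.rightInvSeq ω).count t := by
  simp [inversionParity, signedConjHom_wordProd]

lemma signedConjHom_apply (w t : W) (e : ZMod 2) :
    cs.signedConjHom w (t, e) = (w * t * w⁻¹, e + cs.inversionParity w t) := by
  classical
  obtain ⟨ω, rfl⟩ := cs.wordProd_surjective w
  rw [inversionParity_wordProd, signedConjHom_wordProd]

lemma inversionParity_mul (v w t : W) :
    cs.inversionParity (v * w) t =
      cs.inversionParity w t + cs.inversionParity v (w * t * w⁻¹) := by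
  rw [inversionParity, map_mul, Function.End.mul_apply', signedConjHom_apply,
    signedConjHom_apply, zero_add]

lemma inversionParity_one (t : W) : cs.inversionParity 1 t = 0 := by
  simp [inversionParity, Function.End.one_apply']

lemma inversionParity_simple_self (i : B) :
    cs.inversionParity (cs.simple i) (cs.simple i) = 1 := by
  simp [inversionParity, signedConjHom_simple, signedConj]

-- Writing `t` as a conjugate `w * s * w⁻¹`, the contributions of `w` and `w⁻¹` cancel by the
-- cocycle identity, leaving that of `s` at itself.
variable {cs} in
lemma IsReflection.inversionParity_self {t : W} (ht : cs.IsReflection t) :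
    cs.inversionParity t t = 1 := by
  obtain ⟨w, i, rfl⟩ := ht
  have h := cs.inversionParity_mul w w⁻¹ (w * cs.simple i * w⁻¹)
  rw [mul_inv_cancel, inversionParity_one] at h
  rw [inversionParity_mul, inversionParity_mul]
  simp only [inv_inv, mul_assoc, inv_mul_cancel_left, inv_mul_cancel, mul_one, one_mul,
    simple_mul_simple_self, inv_simple, inversionParity_simple_self] at h ⊢
  rw [add_left_comm, ← h, add_zero]

lemma isRightInversion_of_inversionParity_ne_zero {w t : W} (h : cs.inversionParity w t ≠ 0) :
    cs.IsRightInversion w t := by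
  classical
  obtain ⟨ω, hω, rfl⟩ := cs.exists_isReduced w
  rw [inversionParity_wordProd] at h
  refine cs.isRightInversion_of_mem_rightInvSeq hω (List.count_pos_iff.mp ?_)
  exact Nat.pos_of_ne_zero fun h0 ↦ h (by simp [h0])

lemma inversionParity_ne_zero_of_isRightInversion {w t : W} (h : cs.IsRightInversion w t) :
    cs.inversionParity w t ≠ 0 := by
  intro h0
  -- Multiplying by `t` flips the parity, so `t` would also be an inversion of `w * t`.
  have h1 : cs.inversionParity (w * t) t ≠ 0 := by
    rw [inversionParity_mul, h.1.inversionParity_self, mul_assoc, mul_inv_cancel, mul_one, h0]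
    decide
  have h2 := (cs.isRightInversion_of_inversionParity_ne_zero h1).2
  rw [mul_assoc, h.1.mul_self, mul_one] at h2
  exact lt_asymm h2 h.2

/-- The strong exchange property: a right inversion of the product of a word, reduced or not,
occurs in the right inversion sequence of the word. -/
theorem mem_rightInvSeq_of_isRightInversion {ω : List B} {t : W}
    (h : cs.IsRightInversion (cs.wordProd ω) t) : t ∈ cs.rightInvSeq ω := by
  classical
  have := cs.inversionParity_ne_zero_of_isRightInversion h
  rw [inversionParity_wordProd] at this
  exact List.count_pos_iff.mp (Nat.pos_of_ne_zero fun h0 ↦ this (by simp [h0]))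

/-! ### The retraction onto a subgroup generated by simple reflections -/

lemma isConj_simple_of_odd {i j : B} (h : Odd (M i j)) :
    IsConj (cs.simple i) (cs.simple j) := by
  obtain ⟨k, hk⟩ := h
  rw [isConj_comm, isConj_iff]
  set p := cs.simple i * cs.simple j with hp
  -- With odd order exponent `2 * k + 1`, `p ^ (k + 1)` is a square root of `p`; since `s_j` inverts
  -- `p`, conjugating `s_j` by it gives `s_j * p⁻¹ = s_i`.
  have h1 : p ^ (k + 1) * p ^ (k + 1) = p := by
    rw [← pow_add, show k + 1 + (k + 1) = M i j + 1 by omega, pow_succ, hp,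
      simple_mul_simple_pow, one_mul]
  have h2 : p ^ (k + 1) * cs.simple j = cs.simple j * (p ^ (k + 1))⁻¹ :=
    eq_mul_inv_of_mul_eq (cs.simple_mul_pow_conj i j (k + 1))
  refine ⟨p ^ (k + 1), ?_⟩
  rw [h2, mul_assoc, ← mul_inv_rev, h1]
  simp [hp]

variable {cs} {I J : Set W}

lemma simple_mem_right_of_notMem (hS : I ∪ J = Set.range cs.simple) {i : B}
    (hi : cs.simple i ∉ I) : cs.simple i ∈ J :=
  ((Set.ext_iff.mp hS _).mpr ⟨i, rfl⟩).resolve_left hi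

lemma even_of_mem_of_notMem (hS : I ∪ J = Set.range cs.simple)
    (hIJ : ∀ s ∈ I, ∀ t ∈ J, ¬ IsConj s t) {i j : B} (hi : cs.simple i ∈ I)
    (hj : cs.simple j ∉ I) : Even (M i j) := by
  by_contra h
  exact hIJ _ hi _ (simple_mem_right_of_notMem hS hj)
    (cs.isConj_simple_of_odd (Nat.not_even_iff_odd.mp h))

variable (cs I) in
open Classical in
/-- The map on the indices underlying the retraction onto `⟨I⟩`. -/
noncomputable def retractionFun (i : B) : W := if cs.simple i ∈ I then cs.simple i else 1

lemma isLiftable_retractionFun (hS : I ∪ J = Set.range cs.simple)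
    (hIJ : ∀ s ∈ I, ∀ t ∈ J, ¬ IsConj s t) : M.IsLiftable (cs.retractionFun I) := by
  intro i j
  unfold retractionFun
  split_ifs with hi hj hj
  · exact cs.simple_mul_simple_pow i j
  · obtain ⟨k, hk⟩ := even_of_mem_of_notMem hS hIJ hi hj
    rw [hk, ← two_mul, pow_mul, mul_one, simple_sq, one_pow]
  · obtain ⟨k, hk⟩ := even_of_mem_of_notMem hS hIJ hj hi
    rw [M.symmetric, hk, ← two_mul, pow_mul, one_mul, simple_sq, one_pow]
  · simp

/-- The retraction onto `⟨I⟩` which deletes all the simple reflections outside `I`. -/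
noncomputable def retraction (hS : I ∪ J = Set.range cs.simple)
    (hIJ : ∀ s ∈ I, ∀ t ∈ J, ¬ IsConj s t) : W →* W :=
  cs.lift ⟨cs.retractionFun I, isLiftable_retractionFun hS hIJ⟩

section retraction

variable (hS : I ∪ J = Set.range cs.simple) (hIJ : ∀ s ∈ I, ∀ t ∈ J, ¬ IsConj s t)

open Classical in
lemma retraction_simple (i : B) :
    retraction hS hIJ (cs.simple i) = if cs.simple i ∈ I then cs.simple i else 1 :=
  cs.lift_apply_simple (isLiftable_retractionFun hS hIJ) i

lemma retraction_eq_self {w : W} (hw : w ∈ Subgroup.closure I) : retraction hS hIJ w = w := by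
  refine MonoidHom.eqOn_closure (f := retraction hS hIJ) (g := MonoidHom.id W) ?_ hw
  intro s hs
  obtain ⟨i, rfl⟩ := (Set.ext_iff.mp hS s).mp (Or.inl hs)
  simp [retraction_simple, hs]

lemma notMem_left_of_mem_right (hIJ : ∀ s ∈ I, ∀ t ∈ J, ¬ IsConj s t) {s : W} (hs : s ∈ J) :
    s ∉ I := fun h ↦ hIJ s h s hs (IsConj.refl s)

lemma retraction_eq_one {w : W} (hw : w ∈ Subgroup.closure (conjugatesUnder I J)) :
    retraction hS hIJ w = 1 := by
  refine MonoidHom.eqOn_closure (f := retraction hS hIJ) (g := (1 : W →* W)) ?_ hw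
  rintro _ ⟨w, -, s, hs, rfl⟩
  obtain ⟨i, rfl⟩ := (Set.ext_iff.mp hS s).mp (Or.inr hs)
  simp [retraction_simple, notMem_left_of_mem_right hIJ hs]

include hS hIJ in
lemma disjoint_closure : Disjoint (Subgroup.closure (conjugatesUnder I J)) (Subgroup.closure I) := by
  rw [Subgroup.disjoint_def]
  intro w hw hw'
  rw [← retraction_eq_self hS hIJ hw', retraction_eq_one hS hIJ hw]

lemma subset_conjugatesUnder : J ⊆ conjugatesUnder I J :=
  fun s hs ↦ ⟨1, one_mem _, s, hs, by simp⟩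

lemma conj_mem_conjugatesUnder {w t : W} (hw : w ∈ Subgroup.closure I)
    (ht : t ∈ conjugatesUnder I J) : w * t * w⁻¹ ∈ conjugatesUnder I J := by
  obtain ⟨v, hv, s, hs, rfl⟩ := ht
  exact ⟨w * v, mul_mem hw hv, s, hs, by group⟩

include hS in
lemma closure_union_eq_top : Subgroup.closure (I ∪ J) = ⊤ := by
  rw [hS, cs.subgroup_closure_range_simple]

-- Elements of `I` permute the generating set by conjugation, and elements of `J` already lie in the
-- subgroup.
include hS in
lemma normal_closure_conjugatesUnder : (Subgroup.closure (conjugatesUnder I J)).Normal := by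
  rw [← Subgroup.normalizer_eq_top_iff, eq_top_iff, ← closure_union_eq_top hS,
    Subgroup.closure_le]
  rintro s (hs | hs)
  · refine Subgroup.normalizer_le_normalizer_closure _ ?_
    have hs' := Subgroup.subset_closure hs
    refine fun h ↦ ⟨conj_mem_conjugatesUnder hs', fun h' ↦ ?_⟩
    simpa [mul_assoc] using conj_mem_conjugatesUnder (inv_mem hs') h'
  · exact Subgroup.le_normalizer (Subgroup.subset_closure (subset_conjugatesUnder hs))

include hS hIJ in
lemma isComplement'_closure :
    Subgroup.IsComplement' (Subgroup.closure (conjugatesUnder I J)) (Subgroup.closure I) := by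
  have := normal_closure_conjugatesUnder hS
  refine Subgroup.isComplement'_of_disjoint_and_mul_eq_univ (disjoint_closure hS hIJ) ?_
  rw [← Subgroup.normal_mul, ← Subgroup.coe_top, SetLike.coe_set_eq, eq_top_iff,
    ← closure_union_eq_top hS, Subgroup.closure_le]
  rintro s (hs | hs)
  · exact Subgroup.mem_sup_right (Subgroup.subset_closure hs)
  · exact Subgroup.mem_sup_left (Subgroup.subset_closure (subset_conjugatesUnder hs))

/-! ### Lengths under the retraction and minimal coset elements. -/

open Classical in
lemma length_retraction_wordProd_add_countP_le (ω : List B) :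
    cs.length (retraction hS hIJ (cs.wordProd ω)) + ω.countP (cs.simple · ∉ I) ≤ ω.length := by
  induction ω with
  | nil => simp
  | cons i ω ih =>
    rw [wordProd_cons, map_mul, retraction_simple, List.countP_cons, List.length_cons]
    have h1 := cs.length_mul_le (cs.simple i) (retraction hS hIJ (cs.wordProd ω))
    rw [length_simple] at h1
    by_cases hi : cs.simple i ∈ I
    · simp only [hi, if_true, not_true_eq_false, decide_false, Bool.false_eq_true, if_false]
      omega
    · simp only [hi, if_false, not_false_eq_true, decide_true, if_true, one_mul]
      omega

lemma wordProd_mem_closure {ω : List B} (h : ∀ i ∈ ω, cs.simple i ∈ I) :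
    cs.wordProd ω ∈ Subgroup.closure I := by
  refine Subgroup.list_prod_mem _ fun x hx ↦ ?_
  obtain ⟨i, hi, rfl⟩ := List.mem_map.mp hx
  exact Subgroup.subset_closure (h i hi)

lemma length_retraction_le (w : W) : cs.length (retraction hS hIJ w) ≤ cs.length w := by
  classical
  obtain ⟨ω, hω, rfl⟩ := cs.exists_isReduced w
  have := length_retraction_wordProd_add_countP_le hS hIJ ω
  rw [hω.eq]
  omega

lemma mem_closure_of_length_retraction_eq {w : W}
    (h : cs.length w ≤ cs.length (retraction hS hIJ w)) : w ∈ Subgroup.closure I := by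
  classical
  obtain ⟨ω, hω, rfl⟩ := cs.exists_isReduced w
  have h' := length_retraction_wordProd_add_countP_le hS hIJ ω
  rw [hω.eq] at h
  have h0 : ω.countP (cs.simple · ∉ I) = 0 := by omega
  rw [List.countP_eq_zero] at h0
  exact wordProd_mem_closure fun i hi ↦ by simpa using h0 i hi

include hS hIJ in
lemma minLengthElements_op_smul {w : W} (hw : w ∈ Subgroup.closure I) :
    -- The retraction is constant on the coset with value `w`, and it preserves length only on
    -- `⟨I⟩`, where it is the identity.
    cs.minLengthElements
      (MulOpposite.op w • (Subgroup.closure (conjugatesUnder I J) : Set W)) = {w} := by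
  have hr : ∀ y ∈ MulOpposite.op w • (Subgroup.closure (conjugatesUnder I J) : Set W),
      retraction hS hIJ y = w := by
    rintro _ ⟨u, hu, rfl⟩
    simp [retraction_eq_one hS hIJ hu, retraction_eq_self hS hIJ hw]
  have hmem : w ∈ MulOpposite.op w • (Subgroup.closure (conjugatesUnder I J) : Set W) :=
    ⟨1, one_mem _, by simp⟩
  refine Set.eq_singleton_iff_unique_mem.mpr ⟨⟨hmem, fun y hy ↦ ?_⟩, fun x hx ↦ ?_⟩
  · rw [← hr y hy]
    exact length_retraction_le hS hIJ y
  · rw [← hr x hx.1, retraction_eq_self hS hIJ]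
    refine mem_closure_of_length_retraction_eq hS hIJ ?_
    rw [hr x hx.1]
    exact hx.2 w hmem

/-! ### The canonical generators -/

include hS in
/-- In a word which involves a simple reflection outside `I`, the last such letter gives a
`W_I`-conjugate of an element of `J` in the right inversion sequence. -/
lemma exists_mem_rightInvSeq {ω : List B} (h : ∃ i ∈ ω, cs.simple i ∉ I) :
    ∃ t ∈ cs.rightInvSeq ω, t ∈ conjugatesUnder I J := by
  induction ω with
  | nil => simp at h
  | cons i ω ih =>
    by_cases h' : ∃ j ∈ ω, cs.simple j ∉ I
    · obtain ⟨t, ht, ht'⟩ := ih h'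
      exact ⟨t, List.mem_cons_of_mem _ ht, ht'⟩
    · push Not at h'
      have hi : cs.simple i ∉ I := by
        obtain ⟨j, hj, hj'⟩ := h
        rcases List.mem_cons.mp hj with rfl | hj
        · exact hj'
        · exact absurd (h' j hj) hj'
      exact ⟨_, List.mem_cons_self, (cs.wordProd ω)⁻¹, inv_mem (wordProd_mem_closure h'), _,
        simple_mem_right_of_notMem hS hi, by simp⟩

include hS in
lemma exists_wordProd_eq {w : W} (hw : w ∈ Subgroup.closure I) :
    ∃ ω : List B, (∀ i ∈ ω, cs.simple i ∈ I) ∧ cs.wordProd ω = w := by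
  induction hw using Subgroup.closure_induction with
  | mem s hs =>
    obtain ⟨i, rfl⟩ := (Set.ext_iff.mp hS s).mp (Or.inl hs)
    exact ⟨[i], by simpa using hs, by simp⟩
  | one => exact ⟨[], by simp, by simp⟩
  | mul x y _ _ hx hy =>
    obtain ⟨ω, hω, rfl⟩ := hx
    obtain ⟨ω', hω', rfl⟩ := hy
    exact ⟨ω ++ ω', by simpa [or_imp, forall_and] using ⟨hω, hω'⟩, cs.wordProd_append ω ω'⟩
  | inv x _ hx =>
    obtain ⟨ω, hω, rfl⟩ := hx
    exact ⟨ω.reverse, by simpa using hω, cs.wordProd_reverse ω⟩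

include hS in
lemma isReflection_of_mem_conjugatesUnder {t : W} (ht : t ∈ conjugatesUnder I J) :
    cs.IsReflection t := by
  obtain ⟨w, -, s, hs, rfl⟩ := ht
  obtain ⟨i, rfl⟩ := (Set.ext_iff.mp hS s).mp (Or.inr hs)
  exact ⟨w, i, rfl⟩

lemma IsReflection.ne_one {t : W} (ht : cs.IsReflection t) : t ≠ 1 := by
  rintro rfl
  simpa using ht.odd_length

include hS hIJ in
/-- An element of `⟨I⟩` has no inversions in the normal closure of `J`. -/
lemma inversionParity_eq_zero {w t : W} (hw : w ∈ Subgroup.closure I) (ht : cs.IsReflection t)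
    (ht' : t ∈ Subgroup.closure (conjugatesUnder I J)) : cs.inversionParity w t = 0 := by
  classical
  obtain ⟨ω, hω, rfl⟩ := exists_wordProd_eq hS hw
  by_contra h
  have hmem := cs.mem_rightInvSeq_of_isRightInversion
    (cs.isRightInversion_of_inversionParity_ne_zero h)
  obtain ⟨k, hk, hkt⟩ := List.mem_iff_getElem.mp hmem
  rw [length_rightInvSeq] at hk
  rw [getElem_rightInvSeq _ _ _ hk] at hkt
  -- As an entry of the inversion sequence of a word in `I`, `t` lies in `⟨I⟩` too, hence is
  -- trivial.
  refine ht.ne_one ((Subgroup.disjoint_def.mp (disjoint_closure hS hIJ)) ht' ?_)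
  have hd : cs.wordProd (ω.drop (k + 1)) ∈ Subgroup.closure I :=
    wordProd_mem_closure fun i hi ↦ hω i (List.mem_of_mem_drop hi)
  rw [← hkt]
  refine mul_mem (mul_mem (inv_mem hd) ?_) hd
  exact Subgroup.subset_closure (by simpa [hk] using hω _ (List.getElem_mem hk))

lemma eq_of_inversionParity_simple_ne_zero {i : B} {t : W}
    (h : cs.inversionParity (cs.simple i) t ≠ 0) : t = cs.simple i := by
  have := cs.mem_rightInvSeq_of_isRightInversion (ω := [i]) (t := t)
    (by simpa using cs.isRightInversion_of_inversionParity_ne_zero h)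
  simpa using this

include hS hIJ in
lemma inversionSet_inter_closure {t : W} (ht : t ∈ conjugatesUnder I J) :
    cs.inversionSet t ∩ Subgroup.closure (conjugatesUnder I J) = {t} := by
  have hrefl := isReflection_of_mem_conjugatesUnder hS ht
  have hN := normal_closure_conjugatesUnder hS
  refine Set.eq_singleton_iff_unique_mem.mpr
    ⟨⟨⟨hrefl, ?_⟩, Subgroup.subset_closure ht⟩, ?_⟩
  · rw [hrefl.mul_self, length_one]
    exact Nat.pos_of_ne_zero fun h ↦ hrefl.ne_one (cs.length_eq_zero_iff.mp h)
  · rintro r ⟨hr, hrW⟩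
    have h := cs.inversionParity_ne_zero_of_isRightInversion hr
    obtain ⟨w, hw, s, hs, rfl⟩ := ht
    obtain ⟨i, rfl⟩ := (Set.ext_iff.mp hS s).mp (Or.inr hs)
    have h1 := hr.1.conj w⁻¹
    have h2 := hN.conj_mem r hrW w⁻¹
    -- The cocycle identity leaves only the parity of the simple reflection at `w⁻¹ * r * w`, as the
    -- outer factors contribute nothing.
    rw [inversionParity_mul, inversionParity_mul,
      inversionParity_eq_zero hS hIJ (inv_mem hw) hr.1 hrW,
      inversionParity_eq_zero hS hIJ hw (h1.conj _) (hN.conj_mem _ h2 _), zero_add,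
      add_zero] at h
    rw [← eq_of_inversionParity_simple_ne_zero h]
    group

include hS hIJ in
lemma conjugatesUnder_eq_canonicalGenerators :
    conjugatesUnder I J = cs.canonicalGenerators (Subgroup.closure (conjugatesUnder I J)) := by
  refine Set.Subset.antisymm (fun t ht ↦ ⟨isReflection_of_mem_conjugatesUnder hS ht,
    inversionSet_inter_closure hS hIJ ht⟩) ?_
  rintro t ⟨ht, htN⟩
  have htW : t ∈ Subgroup.closure (conjugatesUnder I J) := (htN.ge rfl).2
  obtain ⟨ω, hω, hωt⟩ := cs.exists_isReduced t
  have h : ∃ i ∈ ω, cs.simple i ∉ I := by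
    by_contra! h
    exact ht.ne_one (Subgroup.disjoint_def.mp (disjoint_closure hS hIJ) htW
      (hωt ▸ wordProd_mem_closure h))
  obtain ⟨r, hr, hr'⟩ := exists_mem_rightInvSeq hS h
  have hr1 := cs.isRightInversion_of_mem_rightInvSeq hω hr
  rw [← hωt] at hr1
  have : r ∈ ({t} : Set W) := htN ▸ ⟨hr1, Subgroup.subset_closure hr'⟩
  rwa [Set.mem_singleton_iff.mp this] at hr'

end retraction

/-! ### The Coxeter presentation of the normal closure of `J` -/

/-- The Coxeter matrix of a set of involutions, given by the orders of their products. -/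
noncomputable def _root_.CoxeterMatrix.ofInvolutions (X : Set W) (hX : ∀ x ∈ X, x * x = 1) :
    CoxeterMatrix X where
  -- Infinite order gives `0`, the convention for no relation.
  M := Matrix.of fun x y ↦ orderOf ((x : W) * y)
  isSymm := by
    ext x y
    have h := orderOf_inv ((x : W) * y)
    rw [mul_inv_rev, inv_eq_of_mul_eq_one_left (hX x x.2),
      inv_eq_of_mul_eq_one_left (hX y y.2)] at h
    exact h
  diagonal x := by simp [hX x x.2]
  off_diagonal x y hxy h := by
    simp only [Matrix.of_apply, orderOf_eq_one_iff] at h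
    exact hxy (Subtype.ext (mul_right_cancel (h.trans (hX y y.2).symm)))

section presentation

variable {X : Set W} (hX : ∀ x ∈ X, x * x = 1)

/-- A function on a set of involutions lifts to the abstract Coxeter group on that set as soon as
it respects the orders of products. -/
lemma isLiftable_ofInvolutions {G : Type*} [Monoid G] {f : X → G}
    (h : ∀ x y : X, (f x * f y) ^ orderOf ((x : W) * y) = 1) :
    (CoxeterMatrix.ofInvolutions X hX).IsLiftable f := h

/-- The canonical map from the abstract Coxeter group on a set of involutions. -/
noncomputable def ofInvolutionsHom : (CoxeterMatrix.ofInvolutions X hX).Group →* W :=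
  (CoxeterMatrix.ofInvolutions X hX).toCoxeterSystem.lift
    ⟨Subtype.val, isLiftable_ofInvolutions hX fun _ _ ↦ pow_orderOf_eq_one _⟩

lemma ofInvolutionsHom_simple (x : X) :
    ofInvolutionsHom hX ((CoxeterMatrix.ofInvolutions X hX).simple x) = x :=
  (CoxeterMatrix.ofInvolutions X hX).toCoxeterSystem.lift_apply_simple
    (isLiftable_ofInvolutions hX fun _ _ ↦ pow_orderOf_eq_one _) x

lemma ofInvolutions_simple_mul_pow {x y : X} {n : ℕ} (h : ((x : W) * y) ^ n = 1) :
    ((CoxeterMatrix.ofInvolutions X hX).simple x *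
      (CoxeterMatrix.ofInvolutions X hX).simple y) ^ n = 1 := by
  obtain ⟨k, rfl⟩ := orderOf_dvd_of_pow_eq_one h
  have := (CoxeterMatrix.ofInvolutions X hX).toCoxeterSystem.simple_mul_simple_pow x y
  rw [CoxeterMatrix.toCoxeterSystem_simple] at this
  rw [pow_mul]
  change _ ^ (CoxeterMatrix.ofInvolutions X hX x y) = _ at this
  change (_ ^ (CoxeterMatrix.ofInvolutions X hX x y)) ^ k = _
  rw [this, one_pow]

lemma ofInvolutionsHom_range : (ofInvolutionsHom hX).range = Subgroup.closure X := by
  set cs' := (CoxeterMatrix.ofInvolutions X hX).toCoxeterSystem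
  rw [MonoidHom.range_eq_map, ← cs'.subgroup_closure_range_simple, MonoidHom.map_closure,
    ← Set.range_comp]
  congr 1
  ext x
  simp [cs', ofInvolutionsHom_simple]

lemma isCoxeterPair_of_injective (h : Function.Injective (ofInvolutionsHom hX)) :
    IsCoxeterPair (Subgroup.closure X) X := by
  let e : (CoxeterMatrix.ofInvolutions X hX).Group ≃* Subgroup.closure X :=
    ((ofInvolutionsHom hX).ofInjective h).trans
      (MulEquiv.subgroupCongr (ofInvolutionsHom_range hX))
  exact ⟨_, (CoxeterMatrix.ofInvolutions X hX).toCoxeterSystem.map e,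
    fun x ↦ ofInvolutionsHom_simple hX x⟩

variable {K : Subgroup W} (hK : ∀ w ∈ K, ∀ x ∈ X, w * x * w⁻¹ ∈ X)

/-- The endomorphism of the abstract Coxeter group on a set of involutions given by conjugation
by an element of the ambient group which preserves that set. -/
noncomputable def ofInvolutionsConj (w : K) :
    (CoxeterMatrix.ofInvolutions X hX).Group →* (CoxeterMatrix.ofInvolutions X hX).Group :=
  (CoxeterMatrix.ofInvolutions X hX).toCoxeterSystem.lift
    ⟨fun x ↦ (CoxeterMatrix.ofInvolutions X hX).simple ⟨w * x * w⁻¹, hK w w.2 x x.2⟩,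
      isLiftable_ofInvolutions hX fun x y ↦ ofInvolutions_simple_mul_pow hX (by
        simp only [Subgroup.coe_inv]
        rw [show (w : W) * x * (w : W)⁻¹ * (w * y * (w : W)⁻¹) = w * (x * y) * (w : W)⁻¹ by group,
          conj_pow, pow_orderOf_eq_one]
        simp)⟩

lemma ofInvolutionsConj_simple (w : K) (x : X) :
    ofInvolutionsConj hX hK w ((CoxeterMatrix.ofInvolutions X hX).simple x) =
      (CoxeterMatrix.ofInvolutions X hX).simple ⟨w * x * w⁻¹, hK w w.2 x x.2⟩ :=
  (CoxeterMatrix.ofInvolutions X hX).toCoxeterSystem.lift_apply_simple _ x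

lemma ofInvolutions_hom_ext {G : Type*} [Monoid G]
    {f g : (CoxeterMatrix.ofInvolutions X hX).Group →* G}
    (h : ∀ x, f ((CoxeterMatrix.ofInvolutions X hX).simple x) =
      g ((CoxeterMatrix.ofInvolutions X hX).simple x)) : f = g :=
  (CoxeterMatrix.ofInvolutions X hX).toCoxeterSystem.ext_simple h

lemma ofInvolutionsConj_one : ofInvolutionsConj hX hK 1 = MonoidHom.id _ :=
  ofInvolutions_hom_ext hX fun x ↦ by simp [ofInvolutionsConj_simple]

lemma ofInvolutionsConj_mul (v w : K) :
    ofInvolutionsConj hX hK (v * w) =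
      (ofInvolutionsConj hX hK v).comp (ofInvolutionsConj hX hK w) :=
  ofInvolutions_hom_ext hX fun x ↦ by simp [ofInvolutionsConj_simple, mul_assoc]

/-- The conjugation action on the abstract Coxeter group on a set of involutions. -/
noncomputable def ofInvolutionsAut : K →* MulAut (CoxeterMatrix.ofInvolutions X hX).Group where
  toFun w := MonoidHom.toMulEquiv (ofInvolutionsConj hX hK w) (ofInvolutionsConj hX hK w⁻¹)
    (by rw [← ofInvolutionsConj_mul, inv_mul_cancel, ofInvolutionsConj_one])
    (by rw [← ofInvolutionsConj_mul, mul_inv_cancel, ofInvolutionsConj_one])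
  map_one' := MulEquiv.ext fun g ↦ DFunLike.congr_fun (ofInvolutionsConj_one hX hK) g
  map_mul' v w := MulEquiv.ext fun g ↦ DFunLike.congr_fun (ofInvolutionsConj_mul hX hK v w) g

lemma ofInvolutionsAut_simple (w : K) (x : X) :
    ofInvolutionsAut hX hK w ((CoxeterMatrix.ofInvolutions X hX).simple x) =
      (CoxeterMatrix.ofInvolutions X hX).simple ⟨w * x * w⁻¹, hK w w.2 x x.2⟩ :=
  ofInvolutionsConj_simple hX hK w x

end presentation

/-! ### Mapping `W` to a semidirect product over the abstract group. -/

section splitting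

variable (hS : I ∪ J = Set.range cs.simple) (hIJ : ∀ s ∈ I, ∀ t ∈ J, ¬ IsConj s t)

include hS in
lemma mul_self_of_mem_conjugatesUnder : ∀ t ∈ conjugatesUnder I J, t * t = 1 :=
  fun _ ht ↦ (isReflection_of_mem_conjugatesUnder hS ht).mul_self

/-- The abstract Coxeter group on the `⟨I⟩`-conjugates of `J`. -/
abbrev ConjugatesGroup : Type _ :=
  (CoxeterMatrix.ofInvolutions (conjugatesUnder I J) (mul_self_of_mem_conjugatesUnder hS)).Group

/-- The conjugation action of `⟨I⟩` on the abstract Coxeter group on the conjugates of `J`. -/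
noncomputable def conjugatesAut : Subgroup.closure I →* MulAut (ConjugatesGroup hS) :=
  ofInvolutionsAut (mul_self_of_mem_conjugatesUnder hS)
    fun _ hw _ ht ↦ conj_mem_conjugatesUnder hw ht

/-- The generator of the abstract Coxeter group attached to a conjugate of an element of `J`. -/
noncomputable def conjugatesGen (t : conjugatesUnder I J) : ConjugatesGroup hS :=
  (CoxeterMatrix.ofInvolutions _ (mul_self_of_mem_conjugatesUnder hS)).simple t

lemma conjugatesAut_gen (w : Subgroup.closure I) (t : conjugatesUnder I J) :
    conjugatesAut hS w (conjugatesGen hS t) =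
      conjugatesGen hS ⟨w * t * w⁻¹, conj_mem_conjugatesUnder w.2 t.2⟩ :=
  ofInvolutionsAut_simple _ _ w t

lemma conjugatesGen_mul_pow {x y : conjugatesUnder I J} {n : ℕ} (h : ((x : W) * y) ^ n = 1) :
    (conjugatesGen hS x * conjugatesGen hS y) ^ n = 1 :=
  ofInvolutions_simple_mul_pow _ h

open Classical in
/-- The images of the simple reflections in the semidirect product. -/
noncomputable def splittingFun (i : B) :
    ConjugatesGroup hS ⋊[conjugatesAut hS] Subgroup.closure I :=
  if hi : cs.simple i ∈ I then SemidirectProduct.inr ⟨cs.simple i, Subgroup.subset_closure hi⟩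
  else SemidirectProduct.inl (conjugatesGen hS
    ⟨cs.simple i, subset_conjugatesUnder (simple_mem_right_of_notMem hS hi)⟩)

include hIJ in
lemma splittingFun_mul_pow {i j : B} (hi : cs.simple i ∈ I) (hj : cs.simple j ∉ I) :
    (splittingFun hS i * splittingFun hS j) ^ M i j = 1 := by
  obtain ⟨k, hk⟩ := even_of_mem_of_notMem hS hIJ hi hj
  have h := cs.simple_mul_simple_pow i j
  rw [hk, ← two_mul, pow_mul] at h ⊢
  rw [splittingFun, splittingFun, dif_pos hi, dif_neg hj]
  set w : Subgroup.closure I := ⟨cs.simple i, Subgroup.subset_closure hi⟩ with hw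
  have hww : w * w = 1 := Subtype.ext (cs.simple_mul_simple_self i)
  have hw' : w⁻¹ = w := inv_eq_of_mul_eq_one_left hww
  set g := conjugatesGen hS
    ⟨cs.simple j, subset_conjugatesUnder (simple_mem_right_of_notMem hS hj)⟩ with hg
  -- As `M i j = 2 * k`, only the square matters; it is a product of two generators from `Jt`, whose
  -- `k`-th power is already trivial in `W`.
  have : (SemidirectProduct.inr w * SemidirectProduct.inl g :
      ConjugatesGroup hS ⋊[conjugatesAut hS] Subgroup.closure I) ^ 2 =
      SemidirectProduct.inl (conjugatesAut hS w g * g) := by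
    rw [map_mul, SemidirectProduct.inl_aut, hw', sq, mul_assoc, mul_assoc, mul_assoc]
  rw [this, ← map_pow, hg, conjugatesAut_gen, conjugatesGen_mul_pow, map_one]
  simpa [hw, sq, mul_assoc] using h

include hIJ in
lemma isLiftable_splittingFun : M.IsLiftable (splittingFun hS) := by
  intro i j
  by_cases hi : cs.simple i ∈ I <;> by_cases hj : cs.simple j ∈ I
  · rw [splittingFun, splittingFun, dif_pos hi, dif_pos hj, ← map_mul, ← map_pow]
    rw [← map_one SemidirectProduct.inr]
    congr 1
    exact Subtype.ext (cs.simple_mul_simple_pow i j)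
  · exact splittingFun_mul_pow hS hIJ hi hj
  · have h := splittingFun_mul_pow hS hIJ hj hi
    have hi2 : splittingFun hS i * splittingFun hS i = 1 := by
      rw [splittingFun, dif_neg hi, ← map_mul, ← map_one SemidirectProduct.inl]
      congr 1
      simpa using conjugatesGen_mul_pow hS (n := 1)
        (x := ⟨cs.simple i, subset_conjugatesUnder (simple_mem_right_of_notMem hS hi)⟩)
        (y := ⟨cs.simple i, subset_conjugatesUnder (simple_mem_right_of_notMem hS hi)⟩)
        (by simp)
    have hj2 : splittingFun hS j * splittingFun hS j = 1 := by
      rw [splittingFun, dif_pos hj, ← map_mul, ← map_one SemidirectProduct.inr]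
      congr 1
      exact Subtype.ext (cs.simple_mul_simple_self j)
    -- Both images are involutions, so inverting the relation swaps them and reduces to the previous
    -- case.
    rw [← inv_inj, ← inv_pow, mul_inv_rev, inv_eq_of_mul_eq_one_left hi2,
      inv_eq_of_mul_eq_one_left hj2, M.symmetric, h, inv_one]
  · rw [splittingFun, splittingFun, dif_neg hi, dif_neg hj, ← map_mul, ← map_pow,
      conjugatesGen_mul_pow, map_one]
    exact cs.simple_mul_simple_pow i j

/-- The map from the Coxeter group to the semidirect product of the abstract Coxeter group on the
conjugates of `J` with `⟨I⟩`. -/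
noncomputable def splitting :
    W →* ConjugatesGroup hS ⋊[conjugatesAut hS] Subgroup.closure I :=
  cs.lift ⟨splittingFun hS, isLiftable_splittingFun hS hIJ⟩

lemma splitting_simple (i : B) : splitting hS hIJ (cs.simple i) = splittingFun hS i :=
  cs.lift_apply_simple (isLiftable_splittingFun hS hIJ) i

lemma splitting_closure (w : Subgroup.closure I) :
    splitting hS hIJ w = SemidirectProduct.inr w := by
  obtain ⟨w, hw⟩ := w
  induction hw using Subgroup.closure_induction with
  | mem s hs =>
    obtain ⟨i, rfl⟩ := (Set.ext_iff.mp hS s).mp (Or.inl hs)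
    rw [splitting_simple, splittingFun, dif_pos hs]
  | one => exact (map_one _).trans (map_one SemidirectProduct.inr).symm
  | mul x y hx hy ihx ihy =>
    simp only at ihx ihy ⊢
    rw [map_mul, ihx, ihy, ← map_mul]
    rfl
  | inv x hx ihx =>
    simp only at ihx ⊢
    rw [map_inv, ihx, ← map_inv]
    rfl

lemma splitting_conjugate (t : conjugatesUnder I J) :
    splitting hS hIJ t = SemidirectProduct.inl (conjugatesGen hS t) := by
  obtain ⟨_, w, hw, s, hs, rfl⟩ := t
  obtain ⟨i, rfl⟩ := (Set.ext_iff.mp hS s).mp (Or.inr hs)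
  have hi := notMem_left_of_mem_right hIJ hs
  have hw' := splitting_closure hS hIJ ⟨w, hw⟩
  simp only at hw' ⊢
  rw [map_mul, map_mul, map_inv, hw', splitting_simple, splittingFun, dif_neg hi, ← map_inv,
    ← SemidirectProduct.inl_aut, conjugatesAut_gen]
  rfl

include hIJ in
lemma ofInvolutionsHom_conjugatesUnder_injective :
    Function.Injective (ofInvolutionsHom (mul_self_of_mem_conjugatesUnder hS)) := by
  have h : (splitting hS hIJ).comp (ofInvolutionsHom (mul_self_of_mem_conjugatesUnder hS)) =
      SemidirectProduct.inl := ofInvolutions_hom_ext _ fun x ↦ by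
    rw [MonoidHom.comp_apply, ofInvolutionsHom_simple, splitting_conjugate]
    rfl
  refine Function.Injective.of_comp (f := splitting hS hIJ) ?_
  rw [← MonoidHom.coe_comp, h]
  exact SemidirectProduct.inl_injective

end splitting

end CoxeterSystem

open CoxeterSystem in
theorem theorem1p1 {B W : Type*} [Group W] {M : CoxeterMatrix B} (cs : CoxeterSystem M W)
    (I J : Set W) (hS : I ∪ J = Set.range cs.simple)
    (hIJ : ∀ s ∈ I, ∀ t ∈ J, ¬ IsConj s t)
    (W_I Wt : Subgroup W) (Jt : Set W)
    (hW_I : W_I = Subgroup.closure I)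
    (hJt : Jt = conjugatesUnder I J)
    (hWt : Wt = Subgroup.closure Jt) :
    -- (a) `W` is the internal semidirect product of the normal subgroup `Wt` and `W_I`
    (Wt.Normal ∧ Subgroup.IsComplement' Wt W_I) ∧
    -- (b)
    IsCoxeterPair Wt Jt ∧
    -- (c)
    Jt = cs.canonicalGenerators Wt ∧
    -- (d) for `w ∈ W_I`, the cosets `Wt w` and `w Wt` agree, and `w` is the unique element of
    -- minimal length in this coset
    (∀ w ∈ W_I,
      MulOpposite.op w • (Wt : Set W) = w • (Wt : Set W) ∧
      cs.minLengthElements (MulOpposite.op w • (Wt : Set W)) = {w}) := by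
  subst hW_I hJt hWt
  have hN := normal_closure_conjugatesUnder hS
  exact ⟨⟨hN, isComplement'_closure hS hIJ⟩,
    isCoxeterPair_of_injective _ (ofInvolutionsHom_conjugatesUnder_injective hS hIJ),
    conjugatesUnder_eq_canonicalGenerators hS hIJ,
    fun w hw ↦ ⟨(eq_cosets_of_normal _ hN w).symm, minLengthElements_op_smul hS hIJ hw⟩⟩
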